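/- Let $n\ge 1$ and equip $\{0,1\}^n$ with the uniform probability measure, with expectation $\mathbb E$; write $y\sim x$ if $x$ and $y$ differ in exactly one coordinate. All logarithms are natural and $0\log 0=0$. For $g\colon\{0,1\}^n\to[0,\infty)$ let $\mathrm{Ent}(g)=\mathbb E[g\log g]-\mathbb E g\cdot\log\mathbb E g$. Let $H(p)=-p\log p-(1-p)\log(1-p)$, and let $H^{-1}\colon[0,\log 2]\to[0,1/2]$ be the inverse of the restriction of $H$ to $[0,1/2]$. Define $C$ on $[0,\log 2]$ by $$C(x)=\frac4x\left(\frac12-\sqrt{H^{-1}(\log 2-x)\bigl(1-H^{-1}(\log 2-x)\bigr)}\right)\quad(0<x\le\log 2),\qquad C(0)=2 .$$ 1. Let $f\colon\{0,1\}^n\to\mathbb R$ be a non-zero function and let $\rho=\frac1n\,\frac{\mathrm{Ent}(f^2)}{\mathbb E f^2}$. Then $\rho\in[0,\log 2]$ and $$\mathbb E_x\sum_{y\sim x}(f(x)-f(y))^2\ \ge\ C(\rho)\cdot\mathrm{Ent}(f^2).$$ 2. The function $C$ is strictly increasing and convex on $[0,\log 2]$, maps this interval onto $[2,2/\log 2]$,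 and satisfies $\lim_{x\to0^+}C(x)=2$ (so that $C(0)=2$ is the limit value). -/

import Mathlib

open scoped Topology

noncomputable section

namespace HammingCube

/-- The Hamming cube `{0,1}^n`. -/
abbrev Cube (n : ℕ) : Type := Fin n → Bool

/-- Expectation with respect to the uniform measure on the cube. -/
def expect {n : ℕ} (g : Cube n → ℝ) : ℝ := (∑ x, g x) / 2 ^ n

/-- The neighbours of `x`: the vertices that differ from `x` in exactly one coordinate. -/
def neighbors {n : ℕ} (x : Cube n) : Finset (Cube n) :=
  Finset.univ.filter (fun y => hammingDist x y = 1)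

/-- The variation (Dirichlet form) `E_x ∑_{y ∼ x} (f x - f y)^2`. -/
def variation {n : ℕ} (f : Cube n → ℝ) : ℝ :=
  expect fun x => ∑ y ∈ neighbors x, (f x - f y) ^ 2

/-- The entropy `Ent g = E (g log g) - (E g) log (E g)` of a nonnegative function, with natural
logarithms and the convention `0 log 0 = 0` (which holds for `Real.log`). -/
def ent {n : ℕ} (g : Cube n → ℝ) : ℝ :=
  expect (fun x => g x * Real.log (g x)) - expect g * Real.log (expect g)

/-- The normalized entropy `ρ = (1/n) * Ent (f^2) / E (f^2)`. -/
def rho {n : ℕ} (f : Cube n → ℝ) : ℝ :=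
  1 / (n : ℝ) * (ent (fun x => f x ^ 2) / expect (fun x => f x ^ 2))

/-- The inverse `[0, log 2] → [0, 1/2]` of the natural-logarithm binary entropy function
`H x = - x log x - (1 - x) log (1 - x)` restricted to `[0, 1/2]`. -/
def entropyInv (y : ℝ) : ℝ := Function.invFunOn Real.binEntropy (Set.Icc 0 2⁻¹) y

theorem entropyInv_spec {y : ℝ} (hy : y ∈ Set.Icc 0 (Real.log 2)) :
    entropyInv y ∈ Set.Icc (0 : ℝ) 2⁻¹ ∧ Real.binEntropy (entropyInv y) = y := by
  have h : y ∈ Real.binEntropy '' Set.Icc 0 2⁻¹ := by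
    apply intermediate_value_Icc (by norm_num) Real.binEntropy_continuous.continuousOn
    simpa using hy
  exact ⟨Function.invFunOn_mem h, Function.invFunOn_eq h⟩

/-- The function `C x = (4/x) (1/2 - √(H⁻¹(log 2 - x) (1 - H⁻¹(log 2 - x))))` on `[0, log 2]`,
where the value at `0` is the limit value `2`. -/
def C (x : ℝ) : ℝ :=
  if x = 0 then 2
  else 4 / x * (1 / 2 -
    √(entropyInv (Real.log 2 - x) * (1 - entropyInv (Real.log 2 - x))))

end HammingCube

end

/-
Write `u` for half the log-odds of the coin with bias `q = H⁻¹(log 2 - x)`. Then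
`x * C x = 2 - 4 * √(q * (1 - q)) = 2 - 2 / cosh u`, and differentiating `H q = log 2 - x` shows
that `x * C x` has derivative `2 * sinh u / u`. Hence `C x` is the mean of `2 * sinh u / u` over
`[0, x]`. Since `sinh u / u` is increasing and convex as a function of `x`, so is `C`.

It follows that `x * C x` is convex, hence the supremum of its affine minorants `a * x + b`. For
squared values `s` and `t` on the two-point space, put `m = (s + t) / 2` and let `m * x` be the
entropy of `(s, t)`; then `(√s - √t)² = m * (x * C x)`. So every minorant gives the two-point
inequality `a * Ent + b * m ≤ (√s - √t)²`. Being linear in `Ent` and `m`, it tensorizes: induction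
on `n` gives `a * Ent(f²) + b * n * E(f²) ≤ E ∑ (f x - f y)²`, the new coordinate being handled by
`(‖f₀‖ - ‖f₁‖)² ≤ ‖f₀ - f₁‖²` for the two halves `f₀`, `f₁` of `f`. The supremum over the minorants
at `x = ρ` is the claim.
-/

noncomputable section

namespace HammingCube

open Real Set Filter Function

section MeanValues

variable {b : ℝ} {c g : ℝ → ℝ}

-- If `x * c x` has derivative `g x`, then `c x` is the mean of `t ↦ g (t * x)` over `[0, 1]`.
-- Hence `c` inherits monotonicity and convexity from `g`. Differentiating in `t` avoids the
-- integral, which would require `g` to be integrable up to the endpoint `b`.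

theorem hasDerivAt_mul_comp_mul (h₀ : c 0 = g 0)
    (hg : ∀ x ∈ Ioo 0 b, HasDerivAt (fun x => x * c x) (g x) x)
    {x t : ℝ} (hx : x ∈ Icc 0 b) (ht : t ∈ Ioo 0 1) :
    HasDerivAt (fun t => t * c (t * x)) (g (t * x)) t := by
  rcases hx.1.eq_or_lt with rfl | hx₀
  · simpa [h₀] using hasDerivAt_mul_const (x := t) (g 0)
  · have htx : t * x ∈ Ioo 0 b :=
      ⟨mul_pos ht.1 hx₀, (mul_lt_of_lt_one_left hx₀ ht.2).trans_le hx.2⟩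
    have h := ((hg _ htx).comp t (hasDerivAt_mul_const x)).div_const x
    rw [mul_div_cancel_right₀ _ hx₀.ne'] at h
    refine h.congr_of_eventuallyEq (.of_forall fun s => ?_)
    simp only [comp_apply]
    field_simp

theorem continuousOn_mul_comp_mul (hc : ContinuousOn c (Icc 0 b)) {x : ℝ} (hx : x ∈ Icc 0 b) :
    ContinuousOn (fun t => t * c (t * x)) (Icc 0 1) :=
  continuousOn_id.mul <| hc.comp (by fun_prop) fun _ ht =>
    ⟨mul_nonneg ht.1 hx.1, (mul_le_of_le_one_left hx.1 ht.2).trans hx.2⟩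

theorem strictMonoOn_of_hasDerivAt_id_mul (hc : ContinuousOn c (Icc 0 b)) (h₀ : c 0 = g 0)
    (hg : ∀ x ∈ Ioo 0 b, HasDerivAt (fun x => x * c x) (g x) x)
    (hmono : StrictMonoOn g (Ico 0 b)) : StrictMonoOn c (Icc 0 b) := by
  intro x hx y hy hxy
  have h : StrictMonoOn (fun t => t * c (t * y) - t * c (t * x)) (Icc 0 1) := by
    refine strictMonoOn_of_hasDerivWithinAt_pos (f' := fun t => g (t * y) - g (t * x))
      (convex_Icc 0 1)
      ((continuousOn_mul_comp_mul hc hy).sub (continuousOn_mul_comp_mul hc hx)) ?_ ?_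
    all_goals
      intro t ht
      rw [interior_Icc] at ht
    · exact ((hasDerivAt_mul_comp_mul h₀ hg hy ht).sub
        (hasDerivAt_mul_comp_mul h₀ hg hx ht)).hasDerivWithinAt
    · have hlt : t * x < t * y := mul_lt_mul_of_pos_left hxy ht.1
      have hty : t * y < b := by nlinarith [ht.2, hx.1, hy.2]
      have htx : 0 ≤ t * x := mul_nonneg ht.1.le hx.1
      exact sub_pos.2 (hmono ⟨htx, hlt.trans hty⟩ ⟨htx.trans hlt.le, hty⟩ hlt)
  simpa using h (left_mem_Icc.2 zero_le_one) (right_mem_Icc.2 zero_le_one) one_pos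

theorem convexOn_of_hasDerivAt_id_mul (hb : 0 < b) (hc : ContinuousOn c (Icc 0 b)) (h₀ : c 0 = g 0)
    (hg : ∀ x ∈ Ioo 0 b, HasDerivAt (fun x => x * c x) (g x) x)
    (hconv : ConvexOn ℝ (Ico 0 b) g) : ConvexOn ℝ (Icc 0 b) c := by
  refine ⟨convex_Icc 0 b, fun x hx y hy α β hα hβ hαβ => ?_⟩
  have hz := convex_Icc 0 b hx hy hα hβ hαβ
  simp only [smul_eq_mul] at hz ⊢
  set z := α * x + β * y with hz_def
  have h : MonotoneOn
      (fun t => α * (t * c (t * x)) + β * (t * c (t * y)) - t * c (t * z)) (Icc 0 1) := by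
    refine monotoneOn_of_hasDerivWithinAt_nonneg
      (f' := fun t => α * g (t * x) + β * g (t * y) - g (t * z)) (convex_Icc 0 1)
      (((continuousOn_mul_comp_mul hc hx).const_mul α |>.add
        ((continuousOn_mul_comp_mul hc hy).const_mul β)).sub
        (continuousOn_mul_comp_mul hc hz)) ?_ ?_
    all_goals
      intro t ht
      rw [interior_Icc] at ht
    · exact ((((hasDerivAt_mul_comp_mul h₀ hg hx ht).const_mul α).add
        ((hasDerivAt_mul_comp_mul h₀ hg hy ht).const_mul β)).sub
        (hasDerivAt_mul_comp_mul h₀ hg hz ht)).hasDerivWithinAt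
    · have hmem {w : ℝ} (hw : w ∈ Icc 0 b) : t * w ∈ Ico 0 b :=
        ⟨mul_nonneg ht.1.le hw.1,
          (mul_le_mul_of_nonneg_left hw.2 ht.1.le).trans_lt (mul_lt_of_lt_one_left hb ht.2)⟩
      have := hconv.2 (hmem hx) (hmem hy) hα hβ hαβ
      simp only [smul_eq_mul] at this
      rw [show t * z = α * (t * x) + β * (t * y) by rw [hz_def]; ring]
      exact sub_nonneg.2 this
  simpa using h (left_mem_Icc.2 zero_le_one) (right_mem_Icc.2 zero_le_one) zero_le_one

end MeanValues

section Hyperbolic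

/-- The hyperbolic analogue `sinh u / u` of `Real.sinc`, with its limit value `1` at `0`. -/
def sinhc (u : ℝ) : ℝ := dslope sinh 0 u

theorem sinhc_zero : sinhc 0 = 1 := by
  simp [sinhc]

theorem sinhc_of_ne_zero {u : ℝ} (hu : u ≠ 0) : sinhc u = sinh u / u := by
  simp [sinhc, dslope_of_ne _ hu, slope_def_field]

theorem continuous_sinhc : Continuous sinhc :=
  continuous_iff_continuousAt.2 fun u => by
    rcases eq_or_ne u 0 with rfl | hu
    · exact continuousAt_dslope_same.2 differentiableAt_sinh
    · exact (continuousAt_dslope_of_ne hu).2 continuous_sinh.continuousAt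

theorem hasDerivAt_sinhc {u : ℝ} (hu : u ≠ 0) :
    HasDerivAt sinhc ((u * cosh u - sinh u) / u ^ 2) u := by
  have h := ((hasDerivAt_sinh u).div (hasDerivAt_id u) hu).congr_of_eventuallyEq
    (f₁ := sinhc) ((eventually_ne_nhds hu).mono fun v hv => sinhc_of_ne_zero hv)
  refine h.congr_deriv ?_
  simp only [id]
  ring

theorem pos_of_hasDerivAt_pos {f f' : ℝ → ℝ} (hf₀ : f 0 = 0) (hf : ∀ v, HasDerivAt f (f' v) v)
    (hf' : ∀ v, 0 < v → 0 < f' v) {u : ℝ} (hu : 0 < u) : 0 < f u := by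
  have h : StrictMonoOn f (Ici 0) :=
    strictMonoOn_of_hasDerivWithinAt_pos (convex_Ici 0)
      (fun v _ => (hf v).continuousAt.continuousWithinAt)
      (fun v _ => (hf v).hasDerivWithinAt) fun v hv => hf' v (by rwa [interior_Ici] at hv)
  simpa [hf₀] using h self_mem_Ici (mem_Ici.2 hu.le) hu

theorem hasDerivAt_mul_cosh_sub_sinh (u : ℝ) :
    HasDerivAt (fun u => u * cosh u - sinh u) (u * sinh u) u := by
  refine (((hasDerivAt_id u).mul (hasDerivAt_cosh u)).sub (hasDerivAt_sinh u)).congr_deriv ?_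
  simp only [id]
  ring

theorem mul_cosh_sub_sinh_pos {u : ℝ} (hu : 0 < u) : 0 < u * cosh u - sinh u :=
  pos_of_hasDerivAt_pos (by simp) hasDerivAt_mul_cosh_sub_sinh
    (fun _ hv => mul_pos hv (sinh_pos_iff.2 hv)) hu

theorem three_mul_mul_cosh_sub_sinh_lt {u : ℝ} (hu : 0 < u) :
    3 * (u * cosh u - sinh u) < u ^ 2 * sinh u := by
  have hd (v : ℝ) : HasDerivAt (fun v => v ^ 2 * sinh v - 3 * (v * cosh v - sinh v))
      (v * (v * cosh v - sinh v)) v := by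
    refine (((hasDerivAt_pow 2 v).mul (hasDerivAt_sinh v)).sub
      ((hasDerivAt_mul_cosh_sub_sinh v).const_mul 3)).congr_deriv ?_
    ring
  exact sub_pos.1 <| pos_of_hasDerivAt_pos (by simp) hd
    (fun _ hv => mul_pos hv (mul_cosh_sub_sinh_pos hv)) hu

theorem strictMonoOn_sinhc : StrictMonoOn sinhc (Ici 0) := by
  refine strictMonoOn_of_hasDerivWithinAt_pos (convex_Ici 0) continuous_sinhc.continuousOn
    (fun u hu => (hasDerivAt_sinhc (ne_of_gt ?_)).hasDerivWithinAt)
    fun u hu => div_pos (mul_cosh_sub_sinh_pos ?_) (pow_pos ?_ 2)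
  all_goals simpa using hu

theorem monotoneOn_mul_cosh_sub_sinh_div_pow :
    MonotoneOn (fun u => (u * cosh u - sinh u) / u ^ 3) (Ioi 0) := by
  have hd {u : ℝ} (hu : 0 < u) : HasDerivAt (fun u => (u * cosh u - sinh u) / u ^ 3)
      ((u ^ 2 * sinh u - 3 * (u * cosh u - sinh u)) / u ^ 4) u := by
    refine ((hasDerivAt_mul_cosh_sub_sinh u).div (hasDerivAt_pow 3 u)
      (by positivity)).congr_deriv ?_
    field_simp
    ring
  refine monotoneOn_of_hasDerivWithinAt_nonneg (convex_Ioi 0)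
    (fun u hu => (hd hu).continuousAt.continuousWithinAt)
    (fun u hu => (hd (interior_subset hu)).hasDerivWithinAt) fun u hu => ?_
  rw [interior_Ioi] at hu
  exact div_nonneg (sub_nonneg.2 (three_mul_mul_cosh_sub_sinh_lt hu).le) (pow_pos hu 4).le

-- With `u = halfLogOdds x`, this function of `u` is the derivative of `sinhc u` in `x`.
theorem monotoneOn_cosh_sq_mul :
    MonotoneOn (fun u => cosh u ^ 2 * ((u * cosh u - sinh u) / u ^ 3)) (Ioi 0) := by
  have hcosh : MonotoneOn (fun u => cosh u ^ 2) (Ioi 0) := fun u hu v hv huv =>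
    pow_le_pow_left₀ (cosh_pos u).le
      (cosh_strictMonoOn.monotoneOn (mem_Ici_of_Ioi hu) (mem_Ici_of_Ioi hv) huv) 2
  exact hcosh.mul monotoneOn_mul_cosh_sub_sinh_div_pow (fun u _ => sq_nonneg _)
    fun u hu => div_nonneg (mul_cosh_sub_sinh_pos hu).le (pow_pos hu 3).le

end Hyperbolic

section EntropyInverse

theorem log_two_pos : 0 < log 2 := log_pos one_lt_two

theorem binEntropy_mem_Icc {p : ℝ} (hp : p ∈ Icc (0 : ℝ) 1) : binEntropy p ∈ Icc 0 (log 2) :=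
  ⟨binEntropy_nonneg hp.1 hp.2, binEntropy_le_log_two⟩

theorem entropyInv_binEntropy {p : ℝ} (hp : p ∈ Icc (0 : ℝ) 2⁻¹) :
    entropyInv (binEntropy p) = p := by
  have h := entropyInv_spec (binEntropy_mem_Icc ⟨hp.1, hp.2.trans (by norm_num)⟩)
  exact binEntropy_strictMonoOn.injOn h.1 hp h.2

theorem entropyInv_zero : entropyInv 0 = 0 := by
  simpa using entropyInv_binEntropy (p := 0) ⟨le_rfl, by norm_num⟩

theorem entropyInv_log_two : entropyInv (log 2) = 2⁻¹ := by
  simpa using entropyInv_binEntropy (p := 2⁻¹) ⟨by norm_num, le_rfl⟩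

theorem continuousOn_invFunOn {X Y : Type*} [Nonempty X] [TopologicalSpace X]
    [TopologicalSpace Y] [T2Space Y] {f : X → Y} {s : Set X} (hs : IsCompact s)
    (hf : ContinuousOn f s) (hinj : InjOn f s) : ContinuousOn (invFunOn f s) (f '' s) := by
  refine continuousOn_iff_isClosed.2 fun t ht =>
    ⟨f '' (s ∩ t), ((hs.inter_right ht).image_of_continuousOn (hf.mono inter_subset_left)).isClosed,
      ?_⟩
  ext y
  constructor
  · rintro ⟨hyt, hy⟩
    exact ⟨⟨invFunOn f s y, ⟨invFunOn_mem hy, hyt⟩, invFunOn_eq hy⟩, hy⟩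
  · rintro ⟨⟨x, ⟨hx, hxt⟩, rfl⟩, hy⟩
    exact ⟨by rwa [mem_preimage, hinj.leftInvOn_invFunOn hx], hy⟩

theorem continuousOn_entropyInv : ContinuousOn entropyInv (Icc 0 (log 2)) :=
  (continuousOn_invFunOn isCompact_Icc binEntropy_continuous.continuousOn
    binEntropy_strictMonoOn.injOn).mono fun y hy =>
      ⟨entropyInv y, entropyInv_spec hy⟩

end EntropyInverse

section Profile

/-- The probability `q ≤ 1/2` of a coin whose relative entropy `log 2 - H(q)` with respect to the
fair coin is `x`. -/
def bias (x : ℝ) : ℝ := entropyInv (log 2 - x)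

theorem log_two_sub_mem_Icc {x : ℝ} (hx : x ∈ Icc 0 (log 2)) : log 2 - x ∈ Icc 0 (log 2) :=
  ⟨sub_nonneg.2 hx.2, sub_le_self _ hx.1⟩

theorem bias_zero : bias 0 = 2⁻¹ := by
  rw [bias, sub_zero, entropyInv_log_two]

theorem bias_log_two : bias (log 2) = 0 := by
  rw [bias, sub_self, entropyInv_zero]

theorem bias_mem_Icc {x : ℝ} (hx : x ∈ Icc 0 (log 2)) : bias x ∈ Icc 0 2⁻¹ :=
  (entropyInv_spec (log_two_sub_mem_Icc hx)).1

theorem log_two_sub_binEntropy_bias {x : ℝ} (hx : x ∈ Icc 0 (log 2)) :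
    log 2 - binEntropy (bias x) = x := by
  rw [bias, (entropyInv_spec (log_two_sub_mem_Icc hx)).2, sub_sub_cancel]

theorem continuousOn_bias : ContinuousOn bias (Icc 0 (log 2)) :=
  continuousOn_entropyInv.comp (by fun_prop) fun _ hx => log_two_sub_mem_Icc hx

theorem bias_pos {x : ℝ} (hx : x ∈ Ico 0 (log 2)) : 0 < bias x := by
  have hx' := Ico_subset_Icc_self hx
  refine (bias_mem_Icc hx').1.lt_of_ne' fun h => hx.2.ne ?_
  rw [← log_two_sub_binEntropy_bias hx', h, binEntropy_zero, sub_zero]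

theorem bias_lt {x : ℝ} (hx : x ∈ Ioc 0 (log 2)) : bias x < 2⁻¹ := by
  have hx' := Ioc_subset_Icc_self hx
  refine (bias_mem_Icc hx').2.lt_of_ne fun h => hx.1.ne' ?_
  rw [← log_two_sub_binEntropy_bias hx', h, binEntropy_two_inv, sub_self]

/-- Half the log-odds `u` of the coin `bias x`, that is, `bias x = (1 - tanh u) / 2`, for
`x < log 2`. It tends to infinity at `log 2`, where the value here is the junk `0`. -/
def halfLogOdds (x : ℝ) : ℝ := (log (1 - bias x) - log (bias x)) / 2

theorem halfLogOdds_zero : halfLogOdds 0 = 0 := by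
  norm_num [halfLogOdds, bias_zero]

theorem halfLogOdds_pos {x : ℝ} (hx : x ∈ Ioo 0 (log 2)) : 0 < halfLogOdds x := by
  have h := log_lt_log (bias_pos (Ioo_subset_Ico_self hx))
    (show bias x < 1 - bias x by linarith [bias_lt (Ioo_subset_Ioc_self hx)])
  unfold halfLogOdds
  linarith

theorem continuousOn_halfLogOdds : ContinuousOn halfLogOdds (Ico 0 (log 2)) := by
  have h := continuousOn_bias.mono Ico_subset_Icc_self
  refine (((continuousOn_const.sub h).log fun x hx => ?_).sub
    (h.log fun x hx => (bias_pos hx).ne')).div_const 2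
  have := (bias_mem_Icc (Ico_subset_Icc_self hx)).2
  exact ne_of_gt (show (0 : ℝ) < 1 - bias x by linarith)

theorem halfLogOdds_eq_artanh {x : ℝ} (hx : x ∈ Ico 0 (log 2)) :
    halfLogOdds x = artanh (1 - 2 * bias x) := by
  have h₀ := bias_pos hx
  have h₁ := (bias_mem_Icc (Ico_subset_Icc_self hx)).2
  rw [artanh_eq_half_log ⟨by linarith, by linarith⟩,
    show (1 + (1 - 2 * bias x)) / (1 - (1 - 2 * bias x)) = (1 - bias x) / bias x by
      field_simp; ring,
    log_div (by linarith) h₀.ne', halfLogOdds]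
  ring

theorem hasDerivAt_bias {x : ℝ} (hx : x ∈ Ioo 0 (log 2)) :
    HasDerivAt bias (-(2 * halfLogOdds x))⁻¹ x := by
  have hlt := bias_lt (Ioo_subset_Ioc_self hx)
  have hnhds : ∀ᶠ y in 𝓝 x, y ∈ Ioo 0 (log 2) := Ioo_mem_nhds hx.1 hx.2
  have hH : HasDerivAt (fun q => log 2 - binEntropy q) (-(2 * halfLogOdds x)) (bias x) := by
    refine ((hasDerivAt_binEntropy (bias_pos (Ioo_subset_Ico_self hx)).ne'
      (by linarith)).const_sub (log 2)).congr_deriv ?_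
    rw [halfLogOdds, mul_div_cancel₀ _ two_ne_zero]
  refine HasDerivAt.of_local_left_inverse
    (continuousOn_bias.continuousAt (Icc_mem_nhds hx.1 hx.2)) hH ?_
    (hnhds.mono fun y hy => log_two_sub_binEntropy_bias (Ioo_subset_Icc_self hy))
  have := halfLogOdds_pos hx
  simp [this.ne']

theorem sqrt_bias_mul {x : ℝ} (hx : x ∈ Ico 0 (log 2)) :
    √(bias x * (1 - bias x)) = (2 * cosh (halfLogOdds x))⁻¹ := by
  have h₀ := bias_pos hx
  have h₁ := (bias_mem_Icc (Ico_subset_Icc_self hx)).2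
  rw [halfLogOdds_eq_artanh hx, cosh_artanh ⟨by linarith, by linarith⟩,
    show 1 - (1 - 2 * bias x) ^ 2 = 2 ^ 2 * (bias x * (1 - bias x)) by ring,
    sqrt_mul (sq_nonneg (2 : ℝ)), sqrt_sq two_pos.le]
  field_simp

theorem hasDerivAt_halfLogOdds {x : ℝ} (hx : x ∈ Ioo 0 (log 2)) :
    HasDerivAt halfLogOdds (cosh (halfLogOdds x) ^ 2 / halfLogOdds x) x := by
  have h₀ := bias_pos (Ioo_subset_Ico_self hx)
  have h₁ : 0 < 1 - bias x := by linarith [bias_lt (Ioo_subset_Ioc_self hx)]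
  have hu := halfLogOdds_pos hx
  have hcosh : 4 * (bias x * (1 - bias x)) * cosh (halfLogOdds x) ^ 2 = 1 := by
    have := sq_sqrt (mul_pos h₀ h₁).le
    rw [sqrt_bias_mul (Ioo_subset_Ico_self hx)] at this
    rw [← this]
    have := cosh_pos (halfLogOdds x)
    field_simp
    norm_num
  have hd := hasDerivAt_bias hx
  refine (((hd.const_sub 1).log h₁.ne').sub (hd.log h₀.ne')).div_const 2 |>.congr_deriv ?_
  field_simp
  linear_combination (-1 : ℝ) * hcosh

theorem strictMonoOn_halfLogOdds : StrictMonoOn halfLogOdds (Ico 0 (log 2)) := by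
  refine strictMonoOn_of_hasDerivWithinAt_pos (convex_Ico _ _) continuousOn_halfLogOdds
    (fun x hx => (hasDerivAt_halfLogOdds ?_).hasDerivWithinAt)
    fun x hx => div_pos (pow_pos (cosh_pos _) 2) (halfLogOdds_pos ?_)
  all_goals rwa [interior_Ico] at hx

theorem strictMonoOn_sinhc_halfLogOdds :
    StrictMonoOn (fun x => 2 * sinhc (halfLogOdds x)) (Ico 0 (log 2)) := by
  have hnonneg : MapsTo halfLogOdds (Ico 0 (log 2)) (Ici 0) := fun x hx => by
    simpa [halfLogOdds_zero] using
      strictMonoOn_halfLogOdds.monotoneOn (left_mem_Ico.2 log_two_pos) hx hx.1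
  exact fun x hx y hy hxy => mul_lt_mul_of_pos_left
    (strictMonoOn_sinhc.comp strictMonoOn_halfLogOdds hnonneg hx hy hxy) two_pos

theorem convexOn_sinhc_halfLogOdds :
    ConvexOn ℝ (Ico 0 (log 2)) (fun x => 2 * sinhc (halfLogOdds x)) := by
  have hd {x : ℝ} (hx : x ∈ Ioo 0 (log 2)) : HasDerivAt (fun x => 2 * sinhc (halfLogOdds x))
      (2 * (cosh (halfLogOdds x) ^ 2 * ((halfLogOdds x * cosh (halfLogOdds x) -
        sinh (halfLogOdds x)) / halfLogOdds x ^ 3))) x := by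
    have hu := (halfLogOdds_pos hx).ne'
    refine (((hasDerivAt_sinhc hu).comp x (hasDerivAt_halfLogOdds hx)).const_mul 2).congr_deriv ?_
    field_simp
  refine MonotoneOn.convexOn_of_deriv (convex_Ico _ _)
    (continuousOn_const.mul (continuous_sinhc.comp_continuousOn continuousOn_halfLogOdds)) ?_ ?_
  all_goals rw [interior_Ico]
  · exact fun x hx => (hd hx).differentiableAt.differentiableWithinAt
  · intro x hx y hy hxy
    rw [(hd hx).deriv, (hd hy).deriv]
    exact mul_le_mul_of_nonneg_left (monotoneOn_cosh_sq_mul (halfLogOdds_pos hx)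
      (halfLogOdds_pos hy) (strictMonoOn_halfLogOdds.monotoneOn (Ioo_subset_Ico_self hx)
        (Ioo_subset_Ico_self hy) hxy)) two_pos.le

theorem C_zero : C 0 = 2 := if_pos rfl

theorem mul_C (x : ℝ) : x * C x = 2 - 4 * √(bias x * (1 - bias x)) := by
  rcases eq_or_ne x 0 with rfl | hx
  · have h : √((2 : ℝ)⁻¹ * (1 - 2⁻¹)) = 2⁻¹ := by
      rw [show (2 : ℝ)⁻¹ * (1 - 2⁻¹) = 2⁻¹ ^ 2 by norm_num, sqrt_sq (by norm_num)]
    rw [bias_zero, h]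
    norm_num
  · rw [C, if_neg hx, bias]
    field_simp
    ring

theorem C_log_two : C (log 2) = 2 / log 2 := by
  rw [eq_div_iff log_two_pos.ne', mul_comm, mul_C, bias_log_two]
  simp

theorem continuousOn_mul_C : ContinuousOn (fun x => x * C x) (Icc 0 (log 2)) := by
  simp only [mul_C]
  exact continuousOn_const.sub (continuousOn_const.mul
    (continuousOn_bias.mul (continuousOn_const.sub continuousOn_bias)).sqrt)

theorem hasDerivAt_mul_C {x : ℝ} (hx : x ∈ Ioo 0 (log 2)) :
    HasDerivAt (fun x => x * C x) (2 * sinhc (halfLogOdds x)) x := by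
  have hu := (halfLogOdds_pos hx).ne'
  have hcosh := (cosh_pos (halfLogOdds x)).ne'
  have hd := ((((hasDerivAt_cosh _).comp x (hasDerivAt_halfLogOdds hx)).inv hcosh).const_mul
    2).const_sub 2
  refine (hd.congr_of_eventuallyEq ?_).congr_deriv ?_
  · filter_upwards [Ioo_mem_nhds hx.1 hx.2] with y hy
    rw [mul_C, sqrt_bias_mul (Ioo_subset_Ico_self hy), mul_inv]
    simp only [Pi.inv_apply, comp_apply]
    ring
  · rw [sinhc_of_ne_zero hu]
    simp only [comp_apply]
    field_simp

theorem tendsto_C_nhdsGT_zero : Tendsto C (𝓝[>] 0) (𝓝 2) := by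
  have hderiv : Tendsto (deriv fun x => x * C x) (𝓝[>] 0) (𝓝 2) := by
    have h := (continuous_sinhc.comp_continuousOn continuousOn_halfLogOdds).const_smul (2 : ℝ)
      0 (left_mem_Ico.2 log_two_pos)
    simp only [ContinuousWithinAt, comp_apply, Pi.smul_apply, halfLogOdds_zero, sinhc_zero,
      smul_eq_mul, mul_one] at h
    refine ((h.mono_left (nhdsWithin_le_of_mem ?_)).congr' ?_)
    · exact Ico_mem_nhdsGT log_two_pos
    · filter_upwards [Ioo_mem_nhdsGT log_two_pos] with x hx using (hasDerivAt_mul_C hx).deriv.symm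
  have h : HasDerivWithinAt (fun x => x * C x) 2 (Ici 0) 0 :=
    hasDerivWithinAt_Ici_of_tendsto_deriv
      (fun x hx => (hasDerivAt_mul_C hx).differentiableAt.differentiableWithinAt)
      ((continuousOn_mul_C 0 (left_mem_Icc.2 log_two_pos.le)).mono Ioo_subset_Icc_self)
      (Ioo_mem_nhdsGT log_two_pos) hderiv
  rw [hasDerivWithinAt_iff_tendsto_slope, Ici_sdiff_left] at h
  refine h.congr' ?_
  filter_upwards [self_mem_nhdsWithin] with x hx
  have hx' : x ≠ 0 := (mem_Ioi.1 hx).ne'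
  simp [slope_def_field, hx']

theorem continuousOn_C : ContinuousOn C (Icc 0 (log 2)) := by
  intro x hx
  rcases hx.1.eq_or_lt with rfl | hx₀
  · have h : ContinuousWithinAt C (Ioi 0) 0 := by
      simpa only [ContinuousWithinAt, C_zero] using tendsto_C_nhdsGT_zero
    exact (continuousWithinAt_Ioi_iff_Ici.1 h).mono Icc_subset_Ici_self
  · refine ((continuousOn_mul_C x hx).div continuousWithinAt_id hx₀.ne').congr_of_eventuallyEq
      ?_ (mul_div_cancel_left₀ _ hx₀.ne').symm
    filter_upwards [mem_nhdsWithin_of_mem_nhds (eventually_ne_nhds hx₀.ne')] with y hy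
    exact (mul_div_cancel_left₀ _ hy).symm

theorem C_zero_eq_sinhc : C 0 = 2 * sinhc (halfLogOdds 0) := by
  rw [C_zero, halfLogOdds_zero, sinhc_zero, mul_one]

theorem strictMonoOn_C : StrictMonoOn C (Icc 0 (log 2)) :=
  strictMonoOn_of_hasDerivAt_id_mul continuousOn_C C_zero_eq_sinhc
    (fun _ => hasDerivAt_mul_C) strictMonoOn_sinhc_halfLogOdds

theorem convexOn_C : ConvexOn ℝ (Icc 0 (log 2)) C :=
  convexOn_of_hasDerivAt_id_mul log_two_pos continuousOn_C C_zero_eq_sinhc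
    (fun _ => hasDerivAt_mul_C) convexOn_sinhc_halfLogOdds

theorem image_C : C '' Icc 0 (log 2) = Icc 2 (2 / log 2) := by
  have h := continuousOn_C.image_Icc_of_monotoneOn log_two_pos.le strictMonoOn_C.monotoneOn
  rwa [C_zero, C_log_two] at h

theorem convexOn_mul_C : ConvexOn ℝ (Icc 0 (log 2)) (fun x => x * C x) := by
  refine (convexOn_id (convex_Icc 0 (log 2))).mul convexOn_C (fun x hx => hx.1) (fun x hx => ?_)
    (monotoneOn_id.monovaryOn strictMonoOn_C.monotoneOn)
  have h := image_C.subset (mem_image_of_mem C hx)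
  exact two_pos.le.trans h.1

end Profile

section Cube

variable {n : ℕ}

theorem sum_cube_succ (g : Cube (n + 1) → ℝ) :
    ∑ x, g x = ∑ x : Cube n, g (Fin.cons false x) + ∑ x : Cube n, g (Fin.cons true x) := by
  rw [← (Fin.consEquiv fun _ : Fin (n + 1) => Bool).sum_comp, Fintype.sum_prod_type]
  simp [Fin.consEquiv, add_comm]

theorem expect_succ (g : Cube (n + 1) → ℝ) :
    expect g = (expect (fun x : Cube n => g (Fin.cons false x)) +
      expect (fun x : Cube n => g (Fin.cons true x))) / 2 := by
  simp only [expect, sum_cube_succ, pow_succ]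
  field_simp

theorem expect_nonneg {g : Cube n → ℝ} (hg : ∀ x, 0 ≤ g x) : 0 ≤ expect g :=
  div_nonneg (Finset.sum_nonneg fun x _ => hg x) (by positivity)

theorem expect_sq_pos {f : Cube n → ℝ} (hf : f ≠ 0) : 0 < expect fun x => f x ^ 2 := by
  obtain ⟨x, hx⟩ := ne_iff.1 hf
  exact div_pos (Finset.sum_pos' (fun y _ => sq_nonneg (f y))
    ⟨x, Finset.mem_univ x, sq_pos_of_ne_zero hx⟩) (by positivity)

theorem expect_mul_le_sqrt_mul_sqrt (f g : Cube n → ℝ) :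
    expect (fun x => f x * g x) ≤
      √(expect fun x => f x ^ 2) * √(expect fun x => g x ^ 2) := by
  simp only [expect]
  rw [sqrt_div (by positivity), sqrt_div (by positivity), div_mul_div_comm,
    mul_self_sqrt (by positivity)]
  gcongr
  exact sum_mul_le_sqrt_mul_sqrt _ _ _

theorem expect_sub_sq (f g : Cube n → ℝ) :
    expect (fun x => (f x - g x) ^ 2) = expect (fun x => f x ^ 2) -
      2 * expect (fun x => f x * g x) + expect (fun x => g x ^ 2) := by
  simp only [expect, sub_sq, Finset.sum_add_distrib, Finset.sum_sub_distrib, mul_assoc,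
    ← Finset.mul_sum]
  ring

theorem sq_sqrt_expect_sub_le (f g : Cube n → ℝ) :
    (√(expect fun x => f x ^ 2) - √(expect fun x => g x ^ 2)) ^ 2 ≤
      expect fun x => (f x - g x) ^ 2 := by
  rw [expect_sub_sq, sub_sq, sq_sqrt (expect_nonneg fun x => sq_nonneg (f x)),
    sq_sqrt (expect_nonneg fun x => sq_nonneg (g x))]
  linarith [expect_mul_le_sqrt_mul_sqrt f g]

theorem hammingDist_cons (c d : Bool) (x y : Cube n) :
    hammingDist (Fin.cons c x : Cube (n + 1)) (Fin.cons d y) =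
      (if c = d then 0 else 1) + hammingDist x y := by
  simp only [hammingDist, Finset.card_filter, Fin.sum_univ_succ, Fin.cons_zero, Fin.cons_succ]
  split_ifs <;> simp_all

theorem sum_neighbors_cons (c : Bool) (x : Cube n) (g : Cube (n + 1) → ℝ) :
    ∑ y ∈ neighbors (Fin.cons c x : Cube (n + 1)), g y =
      ∑ y ∈ neighbors x, g (Fin.cons c y) + g (Fin.cons (!c) x) := by
  simp only [neighbors, Finset.sum_filter, sum_cube_succ, hammingDist_cons]
  cases c <;> simp [add_comm]

theorem variation_succ (f : Cube (n + 1) → ℝ) :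
    variation f = (variation (fun x : Cube n => f (Fin.cons false x)) +
      variation (fun x : Cube n => f (Fin.cons true x))) / 2 +
      expect (fun x : Cube n => (f (Fin.cons false x) - f (Fin.cons true x)) ^ 2) := by
  rw [variation, expect_succ]
  simp only [sum_neighbors_cons, variation, expect, Finset.sum_add_distrib, Bool.not_true,
    Bool.not_false, sub_sq_comm (f (Fin.cons true _)) (f (Fin.cons false _))]
  ring

/-- The entropy of the function with values `s` and `t` on the uniform two-point space. -/
def twoPointEnt (s t : ℝ) : ℝ :=
  (s * log s + t * log t) / 2 - (s + t) / 2 * log ((s + t) / 2)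

theorem ent_succ (g : Cube (n + 1) → ℝ) :
    ent g = (ent (fun x : Cube n => g (Fin.cons false x)) +
      ent (fun x : Cube n => g (Fin.cons true x))) / 2 +
      twoPointEnt (expect fun x : Cube n => g (Fin.cons false x))
        (expect fun x : Cube n => g (Fin.cons true x)) := by
  simp only [ent, twoPointEnt, expect_succ]
  ring

theorem affine_le_variation_of_twoPoint {a b : ℝ}
    (h : ∀ s t, 0 ≤ s → 0 ≤ t → a * twoPointEnt s t + b * ((s + t) / 2) ≤ (√s - √t) ^ 2)
    (f : Cube n → ℝ) :
    a * ent (fun x => f x ^ 2) + b * (n * expect fun x => f x ^ 2) ≤ variation f := by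
  induction n with
  | zero => simp [ent, expect, variation, neighbors, hammingDist]
  | succ n ih =>
    have hfalse := ih fun x => f (Fin.cons false x)
    have htrue := ih fun x => f (Fin.cons true x)
    have hsplit := (h _ _
      (expect_nonneg fun x : Cube n => sq_nonneg (f (Fin.cons false x)))
      (expect_nonneg fun x : Cube n => sq_nonneg (f (Fin.cons true x)))).trans
      (sq_sqrt_expect_sub_le _ _)
    rw [ent_succ, expect_succ, variation_succ]
    push_cast
    linarith

end Cube

section TwoPoint

variable {s t : ℝ}

theorem div_add_mem_Icc (hs : 0 ≤ s) (ht : 0 ≤ t) : s / (s + t) ∈ Icc (0 : ℝ) 1 :=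
  ⟨by positivity, div_le_one_of_le₀ (by linarith) (by positivity)⟩

theorem twoPointEnt_eq (hs : 0 ≤ s) (ht : 0 ≤ t) :
    twoPointEnt s t = (s + t) / 2 * (log 2 - binEntropy (s / (s + t))) := by
  rcases (add_nonneg hs ht).eq_or_lt' with h₀ | hpos
  · obtain ⟨rfl, rfl⟩ := (add_eq_zero_iff_of_nonneg hs ht).1 h₀
    simp [twoPointEnt]
  have hlog (r : ℝ) : r / (s + t) * log (r / (s + t)) =
      r / (s + t) * (log r - log (s + t)) := by
    rcases eq_or_ne r 0 with rfl | hr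
    · simp
    · rw [log_div hr hpos.ne']
  rw [binEntropy, one_sub_div hpos.ne', add_sub_cancel_left, log_inv, log_inv, mul_neg, mul_neg,
    hlog, hlog, twoPointEnt, log_div hpos.ne' two_ne_zero]
  field_simp
  ring

theorem twoPointEnt_nonneg (hs : 0 ≤ s) (ht : 0 ≤ t) : 0 ≤ twoPointEnt s t := by
  rw [twoPointEnt_eq hs ht]
  exact mul_nonneg (by positivity) (sub_nonneg.2 binEntropy_le_log_two)

theorem twoPointEnt_le (hs : 0 ≤ s) (ht : 0 ≤ t) :
    twoPointEnt s t ≤ (s + t) / 2 * log 2 := by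
  rw [twoPointEnt_eq hs ht]
  exact mul_le_mul_of_nonneg_left
    (sub_le_self _ (binEntropy_mem_Icc (div_add_mem_Icc hs ht)).1) (by positivity)

theorem mul_C_log_two_sub_binEntropy {p : ℝ} (hp : p ∈ Icc (0 : ℝ) 1) :
    (log 2 - binEntropy p) * C (log 2 - binEntropy p) = 2 - 4 * √(p * (1 - p)) := by
  rw [mul_C, bias, sub_sub_cancel]
  rcases le_total p 2⁻¹ with h | h
  · rw [entropyInv_binEntropy ⟨hp.1, h⟩]
  · rw [← binEntropy_one_sub, entropyInv_binEntropy ⟨by linarith [hp.2], by linarith⟩,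
      sub_sub_cancel, mul_comm (1 - p)]

theorem half_add_mul_mul_C (hs : 0 ≤ s) (ht : 0 ≤ t) {x : ℝ}
    (hx : x = log 2 - binEntropy (s / (s + t))) :
    (s + t) / 2 * (x * C x) = (√s - √t) ^ 2 := by
  rcases (add_nonneg hs ht).eq_or_lt' with h₀ | hpos
  · obtain ⟨rfl, rfl⟩ := (add_eq_zero_iff_of_nonneg hs ht).1 h₀
    simp
  have hsqrt : √(s / (s + t) * (1 - s / (s + t))) = √s * √t / (s + t) := by
    rw [one_sub_div hpos.ne', add_sub_cancel_left, div_mul_div_comm, sqrt_div (by positivity),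
      sqrt_mul_self hpos.le, sqrt_mul hs]
  rw [hx, mul_C_log_two_sub_binEntropy (div_add_mem_Icc hs ht), hsqrt, sub_sq, sq_sqrt hs,
    sq_sqrt ht]
  field_simp
  ring

theorem twoPoint_of_affine_le {a b : ℝ} (h : ∀ x ∈ Icc 0 (log 2), a * x + b ≤ x * C x)
    (hs : 0 ≤ s) (ht : 0 ≤ t) :
    a * twoPointEnt s t + b * ((s + t) / 2) ≤ (√s - √t) ^ 2 := by
  have hmem := log_two_sub_mem_Icc (binEntropy_mem_Icc (div_add_mem_Icc hs ht))
  calc a * twoPointEnt s t + b * ((s + t) / 2)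
      = (s + t) / 2 * (a * (log 2 - binEntropy (s / (s + t))) + b) := by
        rw [twoPointEnt_eq hs ht]; ring
    _ ≤ _ := mul_le_mul_of_nonneg_left (h _ hmem) (by positivity)
    _ = _ := half_add_mul_mul_C hs ht rfl

end TwoPoint

section LogSobolev

variable {n : ℕ}

theorem ent_nonneg {g : Cube n → ℝ} (hg : ∀ x, 0 ≤ g x) : 0 ≤ ent g := by
  induction n with
  | zero => simp [ent, expect]
  | succ n ih =>
    have hsplit := twoPointEnt_nonneg (expect_nonneg fun x : Cube n => hg (Fin.cons false x))
      (expect_nonneg fun x : Cube n => hg (Fin.cons true x))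
    rw [ent_succ]
    linarith [ih fun x => hg (Fin.cons false x), ih fun x => hg (Fin.cons true x)]

theorem ent_le {g : Cube n → ℝ} (hg : ∀ x, 0 ≤ g x) : ent g ≤ log 2 * (n * expect g) := by
  induction n with
  | zero => simp [ent, expect]
  | succ n ih =>
    have hsplit := twoPointEnt_le (expect_nonneg fun x : Cube n => hg (Fin.cons false x))
      (expect_nonneg fun x : Cube n => hg (Fin.cons true x))
    rw [ent_succ, expect_succ]
    push_cast
    linarith [ih fun x => hg (Fin.cons false x), ih fun x => hg (Fin.cons true x)]

variable {f : Cube n → ℝ}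

theorem mul_expect_sq_pos (hn : 1 ≤ n) (hf : f ≠ 0) : 0 < n * expect fun x => f x ^ 2 :=
  mul_pos (by positivity) (expect_sq_pos hf)

theorem rho_eq_div : rho f = ent (fun x => f x ^ 2) / (n * expect fun x => f x ^ 2) := by
  rw [rho, one_div_mul_eq_div, div_div, mul_comm]

theorem rho_mem_Icc (hn : 1 ≤ n) (hf : f ≠ 0) : rho f ∈ Icc 0 (log 2) := by
  have hM := mul_expect_sq_pos hn hf
  rw [rho_eq_div]
  exact ⟨div_nonneg (ent_nonneg fun x => sq_nonneg (f x)) hM.le,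
    (div_le_iff₀ hM).2 (ent_le fun x => sq_nonneg (f x))⟩

theorem rho_mul_C_rho_le (hn : 1 ≤ n) (hf : f ≠ 0) :
    rho f * C (rho f) ≤ variation f / (n * expect fun x => f x ^ 2) := by
  have hM := mul_expect_sq_pos hn hf
  refine le_of_forall_lt_imp_le_of_dense fun y hy => ?_
  obtain ⟨a, b, hle, hab⟩ := convexOn_mul_C.exists_affine_le_of_lt_real (rho_mem_Icc hn hf) hy
    isClosed_Icc continuousOn_mul_C.lowerSemicontinuousOn
  have h := affine_le_variation_of_twoPoint (fun _ _ => twoPoint_of_affine_le hle) f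
  rw [← hab, le_div_iff₀ hM, rho_eq_div, add_mul, mul_assoc, div_mul_cancel₀ _ hM.ne']
  exact h

theorem C_rho_mul_ent_le_variation (hn : 1 ≤ n) (hf : f ≠ 0) :
    C (rho f) * ent (fun x => f x ^ 2) ≤ variation f := by
  have hM := mul_expect_sq_pos hn hf
  have h := (le_div_iff₀ hM).1 (rho_mul_C_rho_le hn hf)
  have hent : ent (fun x => f x ^ 2) = rho f * (n * expect fun x => f x ^ 2) := by
    rw [rho_eq_div, div_mul_cancel₀ _ hM.ne']
  rwa [hent, ← mul_assoc, mul_comm (C _)]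

end LogSobolev

end HammingCube

end

theorem theorem1p2 :
    (∀ (n : ℕ), 1 ≤ n → ∀ f : HammingCube.Cube n → ℝ, f ≠ 0 →
      HammingCube.rho f ∈ Set.Icc 0 (Real.log 2) ∧
      HammingCube.variation f ≥
        HammingCube.C (HammingCube.rho f) * HammingCube.ent (fun x => f x ^ 2)) ∧
    StrictMonoOn HammingCube.C (Set.Icc 0 (Real.log 2)) ∧
    ConvexOn ℝ (Set.Icc 0 (Real.log 2)) HammingCube.C ∧
    HammingCube.C '' Set.Icc 0 (Real.log 2) = Set.Icc 2 (2 / Real.log 2) ∧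
    Filter.Tendsto HammingCube.C (𝓝[>] 0) (𝓝 2) :=
  ⟨fun _ hn _ hf =>
      ⟨HammingCube.rho_mem_Icc hn hf, HammingCube.C_rho_mul_ent_le_variation hn hf⟩,
    HammingCube.strictMonoOn_C, HammingCube.convexOn_C, HammingCube.image_C,
    HammingCube.tendsto_C_nhdsGT_zero⟩
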